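/- There is an absolute constant $C>0$ with the following property. Let $n\ge 1$ and let $V:\mathbf{R}^n\to\mathbf{R}$ be bounded and continuous with $V(x)>0$ for all $x\in\mathbf{R}^n$. Let $u_0\in H^1(\mathbf{R}^n)$ and $u_1\in L^2(\mathbf{R}^n)$ be real-valued and suppose that \[ I_0^2:=\int_{\mathbf{R}^n}\frac{|u_1(x)|^2}{V(x)}\,dx<+\infty . \] Then the Cauchy problem \[ u_{tt}-\Delta u+V(x)u=0\quad (t>0,\ x\in\mathbf{R}^n),\qquad u(0,x)=u_0(x),\quad u_t(0,x)=u_1(x) \] has a unique weak solution $u\in C([0,\infty);H^1(\mathbf{R}^n))\cap C^1([0,\infty);L^2(\mathbf{R}^n))$, and it satisfies \[ \|u(t,\cdot)\|_{L^2(\mathbf{R}^n)}\le C\left(\|u_0\|_{L^2(\mathbf{R}^n)}+I_0\right)\qquad\text{for all } t\ge 0 . \] Here $u$ in this class is a weak solution if $u(0)=u_0$ in $H^1(\mathbf{R}^n)$, $u_t(0)=u_1$ in $L^2(\mathbf{R}^n)$ and, for every $w\in H^1(\mathbf{R}^n)$ and every $t>0$, the function $s\mapsto\int_{\mathbf{R}^n}u_t(s,x)w(x)\,dx$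 is differentiable at $t$ with \[ \frac{d}{dt}\int_{\mathbf{R}^n}u_t(t,x)w(x)\,dx+\int_{\mathbf{R}^n}\nabla u(t,x)\cdot\nabla w(x)\,dx+\int_{\mathbf{R}^n}V(x)u(t,x)w(x)\,dx=0 . \] -/

import Mathlib

open MeasureTheory
open scoped ContDiff BoundedContinuousFunction

noncomputable section

namespace WavePotential

/-- `ℝⁿ` with its Euclidean norm and Lebesgue measure. -/
abbrev Space (n : ℕ) : Type := EuclideanSpace ℝ (Fin n)

/-- The real Hilbert space `L²(ℝⁿ)` of real-valued functions. -/
abbrev L2 (n : ℕ) : Type := Lp ℝ 2 (volume : Measure (Space n))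

/-- `g` is the weak partial derivative `∂ᵢ f`, tested against `C_c^∞(ℝⁿ)`. -/
def IsWeakPartial {n : ℕ} (i : Fin n) (f g : L2 n) : Prop :=
  ∀ φ : Space n → ℝ, ContDiff ℝ ∞ φ → HasCompactSupport φ →
    ∫ x, f x * fderiv ℝ φ x (EuclideanSpace.single i 1) = -∫ x, g x * φ x

theorem integrable_mul_test {n : ℕ} (f : L2 n) {ψ : Space n → ℝ} (hψ : Continuous ψ)
    (hc : HasCompactSupport ψ) : Integrable (fun x => f x * ψ x) :=
  (Lp.memLp f).integrable_mul (q := 2) (hψ.memLp_of_hasCompactSupport hc)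

theorem continuous_partial {n : ℕ} (i : Fin n) {φ : Space n → ℝ} (hφ : ContDiff ℝ ∞ φ) :
    Continuous (fun x => fderiv ℝ φ x (EuclideanSpace.single i 1)) :=
  (hφ.continuous_fderiv (by simp)).clm_apply continuous_const

theorem integral_add_mul_test {n : ℕ} (f g : L2 n) {ψ : Space n → ℝ} (hψ : Continuous ψ)
    (hc : HasCompactSupport ψ) :
    ∫ x, (f + g : L2 n) x * ψ x = (∫ x, f x * ψ x) + ∫ x, g x * ψ x := by
  rw [← integral_add (integrable_mul_test f hψ hc) (integrable_mul_test g hψ hc)]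
  refine integral_congr_ae ?_
  filter_upwards [Lp.coeFn_add f g] with x hx
  rw [hx, Pi.add_apply, add_mul]

theorem integral_smul_mul_test {n : ℕ} (c : ℝ) (f : L2 n) (ψ : Space n → ℝ) :
    ∫ x, (c • f : L2 n) x * ψ x = c * ∫ x, f x * ψ x := by
  rw [← integral_const_mul]
  refine integral_congr_ae ?_
  filter_upwards [Lp.coeFn_smul c f] with x hx
  rw [hx, Pi.smul_apply, smul_eq_mul, mul_assoc]

theorem IsWeakPartial.add {n : ℕ} {i : Fin n} {f g f' g' : L2 n}
    (h : IsWeakPartial i f g) (h' : IsWeakPartial i f' g') :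
    IsWeakPartial i (f + f') (g + g') := by
  intro φ hφ hc
  have hc' := hc.fderiv_apply (𝕜 := ℝ) (EuclideanSpace.single i (1 : ℝ))
  rw [integral_add_mul_test f f' (continuous_partial i hφ) hc',
    integral_add_mul_test g g' hφ.continuous hc, h φ hφ hc, h' φ hφ hc]
  ring

theorem IsWeakPartial.smul {n : ℕ} {i : Fin n} {f g : L2 n} (c : ℝ)
    (h : IsWeakPartial i f g) : IsWeakPartial i (c • f) (c • g) := by
  intro φ hφ hc
  rw [integral_smul_mul_test, integral_smul_mul_test, h φ hφ hc]
  ring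

theorem IsWeakPartial.zero {n : ℕ} (i : Fin n) : IsWeakPartial i (0 : L2 n) 0 := by
  intro φ _ _
  have h (ψ : Space n → ℝ) : ∫ x, (0 : L2 n) x * ψ x = 0 := by
    have := integral_smul_mul_test (n := n) 0 0 ψ
    rwa [zero_smul, zero_mul] at this
  rw [h, h, neg_zero]

/-- The Sobolev space `H¹(ℝⁿ)`: functions `f ∈ L²` all of whose weak partial derivatives lie in
`L²`. An element is stored as the pair `(f, ∇f)`; since weak derivatives are unique, `f` determines
`∇f`. The inherited norm is the usual one, `‖f‖² + ∑ᵢ ‖∂ᵢ f‖²` under a square root. -/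
def h1Submodule (n : ℕ) : Submodule ℝ (WithLp 2 (L2 n × PiLp 2 (fun _ : Fin n => L2 n))) where
  carrier := {p | ∀ i, IsWeakPartial i p.fst (p.snd i)}
  add_mem' hp hq i := (hp i).add (hq i)
  zero_mem' i := IsWeakPartial.zero i
  smul_mem' c _ hp i := (hp i).smul c

/-- `H¹(ℝⁿ)` as a type, with the norm inherited from the ambient Hilbert space. -/
abbrev H1 (n : ℕ) : Type := h1Submodule n

/-- The underlying `L²` function of an `H¹` function. -/
def H1.toL2 {n : ℕ} (u : H1 n) : L2 n := u.1.fst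

/-- The weak partial derivative `∂ᵢ u ∈ L²` of an `H¹` function. -/
def H1.partialDeriv {n : ℕ} (i : Fin n) (u : H1 n) : L2 n := u.1.snd i

/-- The bilinear form `∫ ∇u · ∇w + ∫ V u w` of `-Δ + V`. -/
def energyForm {n : ℕ} (V : Space n →ᵇ ℝ) (u w : H1 n) : ℝ :=
  (∑ i, ∫ x, u.partialDeriv i x * w.partialDeriv i x) + ∫ x, V x * u.toL2 x * w.toL2 x

/-- `u ∈ C([0,∞); H¹) ∩ C¹([0,∞); L²)` is a weak solution of `u_tt - Δu + V u = 0` with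
`u(0) = u₀`, `u_t(0) = u₁`; here `u'` is the time derivative `u_t`. Only the values of `u` at
times `t ≥ 0` matter. -/
def IsWeakSolution {n : ℕ} (V : Space n →ᵇ ℝ) (u₀ : H1 n) (u₁ : L2 n) (u : ℝ → H1 n) : Prop :=
  ContinuousOn u (Set.Ici 0) ∧ u 0 = u₀ ∧
  ∃ u' : ℝ → L2 n, ContinuousOn u' (Set.Ici 0) ∧ u' 0 = u₁ ∧
    (∀ t, 0 ≤ t → HasDerivWithinAt (fun s => (u s).toL2) (u' t) (Set.Ici 0) t) ∧
    ∀ w : H1 n, ∀ t, 0 < t →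
      HasDerivAt (fun s => ∫ x, u' s x * w.toL2 x) (-energyForm V (u t) w) t

end WavePotential

end

/-! The bound comes from the energy of the time integral `v(t) = ∫₀ᵗ u`, not of `u`. Integrating the
equation once gives `u' + A v = u₁` weakly, where `A = -Δ + V`. Testing with `u = v'` makes `‖u‖² +
a(v, v) - 2⟪u₁, v⟫` constant, with `a` the form of `A`. Pointwise `2 u₁ v ≤ u₁² / V + V v²`, and `∫
V v² ≤ a(v, v)`, so `‖u(t)‖² ≤ ‖u₀‖² + I₀²`. No lower bound on `V` beyond positivity enters, and `C
= 1` suffices. Applied to a difference of two solutions, the same identity gives uniqueness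
(`IsFormSolution.norm_le`, `IsFormSolution.eq_of_initial_eq`).

Existence is Hille–Yosida written with bounded operators only. The first-order generator `L(p, q) =
(q, -A p)` on `H¹ × L²` enters through `T = (L - κ)⁻¹`, which is bounded, dissipative and injective.
The operators `(T - ε)⁻¹` are the Yosida approximations of `T⁻¹`; their exponentials converge to a
flow with `(T y)' = y` (`IsDissipative.exists_flow`), and `e^{κt} y` solves the wave equation
(`exists_isFormSolution`). -/

noncomputable section

namespace WavePotential

open Filter Topology Set
open scoped RealInnerProductSpace

/-! ### Bounded dissipative operators and their shifted inverses -/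

section Dissipative

variable {X : Type*} [NormedAddCommGroup X] [InnerProductSpace ℝ X]

/-- A bounded operator with nonpositive quadratic form. -/
def IsDissipative (T : X →L[ℝ] X) : Prop := ∀ x, ⟪T x, x⟫ ≤ 0

/-- `G` is the inverse of `T - ε`. -/
structure IsShiftedInverse (T : X →L[ℝ] X) (ε : ℝ) (G : X →L[ℝ] X) : Prop where
  left_inv : G * (T - ε • 1) = 1
  right_inv : (T - ε • 1) * G = 1

/-- Lax–Milgram: dissipativity makes `ε - T` coercive with constant `ε`. -/
theorem IsDissipative.exists_isShiftedInverse [CompleteSpace X] {T : X →L[ℝ] X}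
    (hT : IsDissipative T) {ε : ℝ} (hε : 0 < ε) : ∃ G, IsShiftedInverse T ε G := by
  set R : X →L[ℝ] X := ε • 1 - T with hR
  let B : X →L[ℝ] X →L[ℝ] ℝ := (innerSL ℝ).comp R
  have hB : IsCoercive B := by
    refine ⟨ε, hε, fun x => ?_⟩
    have h1 : B x x = ⟪R x, x⟫ := rfl
    have h2 : ⟪R x, x⟫ = ε * (‖x‖ * ‖x‖) - ⟪T x, x⟫ := by
      simp [hR, inner_sub_left, inner_smul_left, pow_two]
    rw [h1, h2, mul_assoc]
    linarith [hT x]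
  let e := hB.continuousLinearEquivOfBilin
  have he : ∀ x, e x = R x := fun x =>
    (hB.unique_continuousLinearEquivOfBilin (v := x) (f := R x) fun w => rfl).symm
  refine ⟨-(e.symm : X →L[ℝ] X), ?_, ?_⟩
  · ext x
    have h : (T - ε • 1) x = -(e x) := by rw [he]; simp [hR]
    simp only [mul_apply_eq_comp, h]
    simp
  · ext x
    have h : ∀ y, (T - ε • 1) y = -(e y) := fun y => by rw [he]; simp [hR]
    simp only [mul_apply_eq_comp, h]
    simp

namespace IsShiftedInverse

variable {T G G' : X →L[ℝ] X} {ε δ : ℝ}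

theorem apply_right (h : IsShiftedInverse T ε G) (x : X) : T (G x) - ε • G x = x := by
  simpa using DFunLike.congr_fun h.right_inv x

theorem commute (h : IsShiftedInverse T ε G) : Commute T G := by
  have := h.right_inv.trans h.left_inv.symm
  simpa [sub_mul, mul_sub, Commute, SemiconjBy] using this

theorem isDissipative (h : IsShiftedInverse T ε G) (hT : IsDissipative T) (hε : 0 ≤ ε) :
    IsDissipative G := by
  intro x
  have h1 := hT (G x)
  have h2 : ⟪G x, T (G x) - ε • G x⟫ = ⟪T (G x), G x⟫ - ε * ⟪G x, G x⟫ := by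
    rw [inner_sub_right, inner_smul_right, real_inner_comm]
  rw [h.apply_right] at h2
  rw [h2]
  have := mul_nonneg hε (real_inner_self_nonneg (x := G x))
  linarith

/-- Expanding `‖x‖² = ‖T G x - ε G x‖²`, the cross term is nonnegative by dissipativity. The bound
is uniform in `ε`, unlike any bound on `G` alone. -/
theorem norm_comp_le (h : IsShiftedInverse T ε G) (hT : IsDissipative T) (hε : 0 ≤ ε) (x : X) :
    ‖T (G x)‖ ≤ ‖x‖ := by
  have h1 := norm_sub_sq_real (T (G x)) (ε • G x)
  rw [h.apply_right, inner_smul_right] at h1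
  have h2 := mul_nonneg hε (neg_nonneg.2 (hT (G x)))
  refine abs_le_of_sq_le_sq' (a := ‖T (G x)‖) ?_ (norm_nonneg x) |>.2
  nlinarith [sq_nonneg ‖ε • G x‖]

theorem norm_comp_le' (h : IsShiftedInverse T ε G) (hT : IsDissipative T) (hε : 0 ≤ ε) (x : X) :
    ‖G (T x)‖ ≤ ‖x‖ := by
  have : G (T x) = T (G x) := (DFunLike.congr_fun h.commute.eq x).symm
  rw [this]
  exact h.norm_comp_le hT hε x

/-- The resolvent identity. -/
theorem sub_eq (h : IsShiftedInverse T ε G) (h' : IsShiftedInverse T δ G') :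
    G - G' = (ε - δ) • (G' * G) := by
  calc G - G' = (G' * (T - δ • 1)) * G - G' * ((T - ε • 1) * G) := by
        rw [h'.left_inv, h.right_inv]; simp
    _ = (ε - δ) • (G' * G) := by
        simp only [mul_sub, sub_mul, mul_assoc, sub_smul, mul_smul_comm, smul_mul_assoc, one_mul]
        abel

/-- In the resolvent identity each of the two inverses absorbs one factor `T`. -/
theorem norm_sub_apply_sq_le (h : IsShiftedInverse T ε G) (h' : IsShiftedInverse T δ G')
    (hT : IsDissipative T) (hε : 0 ≤ ε) (hδ : 0 ≤ δ) (z : X) :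
    ‖(G - G') (T (T z))‖ ≤ |ε - δ| * ‖z‖ := by
  rw [sub_eq h h']
  have h1 : G (T (T z)) = T (G (T z)) := (DFunLike.congr_fun h.commute.eq (T z)).symm
  simp only [smul_apply, mul_apply_eq_comp, norm_smul, h1,
    Real.norm_eq_abs]
  gcongr
  exact (h'.norm_comp_le' hT hδ _).trans (h.norm_comp_le' hT hε _)

end IsShiftedInverse

/-! ### Contraction semigroups and the limiting flow -/

variable [CompleteSpace X]

theorem hasDerivAt_exp_smul_apply (G : X →L[ℝ] X) (x : X) (t : ℝ) :
    HasDerivAt (fun s : ℝ => NormedSpace.exp (s • G) x) (G (NormedSpace.exp (t • G) x)) t := by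
  simpa using (hasDerivAt_exp_smul_const' (𝕂 := ℝ) G t).clm_apply (hasDerivAt_const t x)

theorem IsDissipative.norm_exp_apply_le {G : X →L[ℝ] X} (hG : IsDissipative G) (x : X)
    {t : ℝ} (ht : 0 ≤ t) : ‖NormedSpace.exp (t • G) x‖ ≤ ‖x‖ := by
  have hd : ∀ s : ℝ, HasDerivAt (fun s : ℝ => ‖NormedSpace.exp (s • G) x‖ ^ 2)
      (2 * ⟪NormedSpace.exp (s • G) x, G (NormedSpace.exp (s • G) x)⟫) s := fun s =>
    (hasDerivAt_exp_smul_apply G x s).norm_sq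
  have hanti : Antitone (fun s : ℝ => ‖NormedSpace.exp (s • G) x‖ ^ 2) := by
    refine antitone_of_hasDerivAt_nonpos hd fun s => ?_
    have := hG (NormedSpace.exp (s • G) x)
    rw [real_inner_comm] at this
    simp only [Pi.zero_apply]
    linarith
  have := hanti ht
  simp only [zero_smul, NormedSpace.exp_zero, one_apply_eq_self] at this
  exact (abs_le_of_sq_le_sq' this (norm_nonneg _)).2

/-- Duhamel: `s ↦ exp((t - s)G') exp(sG)` interpolates between the two exponentials. Its derivative
contains `G - G'`, which commutes past `exp(sG)` to act on `T (T z)`; the exponentials are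
contractions. -/
theorem IsShiftedInverse.norm_exp_sub_exp_le {T G G' : X →L[ℝ] X} {ε δ : ℝ}
    (h : IsShiftedInverse T ε G) (h' : IsShiftedInverse T δ G') (hT : IsDissipative T)
    (hε : 0 ≤ ε) (hδ : 0 ≤ δ) (z : X) {t : ℝ} (ht : 0 ≤ t) :
    ‖NormedSpace.exp (t • G) (T (T z)) - NormedSpace.exp (t • G') (T (T z))‖
      ≤ |ε - δ| * ‖z‖ * t := by
  have hd : ∀ s : ℝ, HasDerivAt
      (fun s : ℝ => NormedSpace.exp ((t - s) • G') (NormedSpace.exp (s • G) (T (T z))))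
      (NormedSpace.exp ((t - s) • G') ((G - G') (NormedSpace.exp (s • G) (T (T z))))) s := by
    intro s
    have h1 := ((hasDerivAt_exp_smul_const (𝕂 := ℝ) G' (t - s)).scomp s
      ((hasDerivAt_id s).const_sub t)).clm_apply (hasDerivAt_exp_smul_apply G (T (T z)) s)
    refine h1.congr_deriv ?_
    have h2 : ((-1 : ℝ) • (NormedSpace.exp ((t - s) • G') * G')) (NormedSpace.exp (s • G) (T (T z)))
        = -NormedSpace.exp ((t - s) • G') (G' (NormedSpace.exp (s • G) (T (T z)))) := by
      rw [neg_one_smul]; rfl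
    rw [h2, neg_add_eq_sub, sub_apply, map_sub]
    rfl
  have hcomm : Commute (G - G') G := by
    have h2 : Commute (T - δ • 1) G := h.commute.sub_left ((Commute.one_left G).smul_left δ)
    have h3 : Commute G' G := by
      calc G' * G = G' * G * ((T - δ • 1) * G') := by rw [h'.right_inv, mul_one]
        _ = G' * ((T - δ • 1) * G) * G' := by rw [h2.eq]; simp only [mul_assoc]
        _ = G * G' := by rw [← mul_assoc, h'.left_inv, one_mul]
    exact (Commute.refl G).sub_left h3
  have hb := norm_image_sub_le_of_norm_deriv_le_segment' (a := 0) (b := t)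
    (C := |ε - δ| * ‖z‖) (fun s _ => (hd s).hasDerivWithinAt) (fun s hs => ?_) t
    (right_mem_Icc.2 ht)
  · simpa using hb
  · refine ((h'.isDissipative hT hδ).norm_exp_apply_le _ (sub_nonneg.2 hs.2.le)).trans ?_
    have h4 : (G - G') (NormedSpace.exp (s • G) (T (T z)))
        = NormedSpace.exp (s • G) ((G - G') (T (T z))) :=
      DFunLike.congr_fun ((hcomm.smul_right s).exp_right).eq (T (T z))
    rw [h4]
    exact ((h.isDissipative hT hε).norm_exp_apply_le _ hs.1).trans
      (h.norm_sub_apply_sq_le h' hT hε hδ z)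

theorem _root_.ContinuousOn.hasDerivWithinAt_integral {f : ℝ → X} (hf : ContinuousOn f (Ici 0))
    {t : ℝ} (ht : 0 ≤ t) :
    HasDerivWithinAt (fun s => ∫ r in (0 : ℝ)..s, f r) (f t) (Ici 0) t := by
  -- extend `f` continuously to the whole line
  set g : ℝ → X := fun s => f (max s 0) with hg
  have hgc : Continuous g :=
    hf.comp_continuous (by fun_prop) fun s => mem_Ici.2 (le_max_right _ _)
  have h1 := (intervalIntegral.integral_hasDerivAt_right (hgc.intervalIntegrable 0 t)
    hgc.aestronglyMeasurable.stronglyMeasurableAtFilter hgc.continuousAt).hasDerivWithinAt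
    (s := Ici 0)
  have h2 : ∀ s ∈ Ici (0 : ℝ), ∫ r in (0 : ℝ)..s, f r = ∫ r in (0 : ℝ)..s, g r := by
    intro s hs
    refine intervalIntegral.integral_congr fun r hr => ?_
    rw [uIcc_of_le hs] at hr
    simp [hg, max_eq_left hr.1]
  have h3 : g t = f t := by simp [hg, max_eq_left ht]
  rw [← h3]
  exact h1.congr h2 (h2 t ht)

/-- Hille–Yosida for the generator `T⁻¹`, where `T` is a bounded dissipative operator with dense
range, stated without unbounded operators. -/
theorem IsDissipative.exists_flow {T : X →L[ℝ] X} (hT : IsDissipative T) (hd : DenseRange T)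
    (x : X) : ∃ y : ℝ → X, ContinuousOn y (Ici 0) ∧ y 0 = x ∧
      ∀ t, 0 ≤ t → HasDerivWithinAt (fun s => T (y s)) (y t) (Ici 0) t := by
  set ε : ℕ → ℝ := fun k => 1 / ((k : ℝ) + 1) with hε
  have hε0 : ∀ k, 0 < ε k := fun k => by positivity
  have hεlim : Tendsto ε atTop (𝓝 0) := tendsto_one_div_add_atTop_nhds_zero_nat
  choose G hG using fun k => hT.exists_isShiftedInverse (hε0 k)
  set Y : ℕ → ℝ → X → X := fun k t x => NormedSpace.exp (t • G k) x with hY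
  have hYle : ∀ k t x, 0 ≤ t → ‖Y k t x‖ ≤ ‖x‖ := fun k t x ht =>
    ((hG k).isDissipative hT (hε0 k).le).norm_exp_apply_le x ht
  have hYc : ∀ k x, Continuous fun t => Y k t x := fun k x =>
    continuous_iff_continuousAt.2 fun t => (hasDerivAt_exp_smul_apply (G k) x t).continuousAt
  have hcauchy : ∀ R : ℝ, UniformCauchySeqOn (fun k t => Y k t x) atTop (Icc 0 R) := by
    intro R
    rw [Metric.uniformCauchySeqOn_iff]
    intro η hη
    -- Uniform contractivity reduces convergence to the dense range of `T²`, where the Duhamel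
    -- estimate is quantitative.
    have hdd : DenseRange (T ∘ T) := hd.comp hd T.continuous
    obtain ⟨z, hz⟩ := hdd.exists_dist_lt x (show 0 < η / 4 by positivity)
    rw [dist_eq_norm] at hz
    have hlim : Tendsto (fun k => ε k * (‖z‖ * |R|)) atTop (𝓝 0) := by
      simpa using hεlim.mul_const (‖z‖ * |R|)
    obtain ⟨N, hN⟩ := (hlim.eventually (gt_mem_nhds (show 0 < η / 8 by positivity))).exists_forall_of_atTop
    refine ⟨N, fun m hm k hk t ht => ?_⟩
    have h1 : ∀ j, ‖Y j t x - Y j t (T (T z))‖ < η / 4 := fun j => by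
      have : Y j t x - Y j t (T (T z)) = Y j t (x - T (T z)) := by simp [hY]
      rw [this]
      exact (hYle j t _ ht.1).trans_lt hz
    have h2 := (hG m).norm_exp_sub_exp_le (hG k) hT (hε0 m).le (hε0 k).le z ht.1
    have h3 : |ε m - ε k| * ‖z‖ * t ≤ ε m * (‖z‖ * |R|) + ε k * (‖z‖ * |R|) := by
      rw [← add_mul, mul_assoc]
      have h4 : |ε m - ε k| ≤ ε m + ε k := by
        rw [abs_le]; constructor <;> linarith [hε0 m, hε0 k]
      have h5 : t ≤ |R| := ht.2.trans (le_abs_self R)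
      have := hε0 m
      have := hε0 k
      have := ht.1
      gcongr
    have h6 := hN m hm
    have h7 := hN k hk
    have h8 : Y m t x - Y k t x = (Y m t x - Y m t (T (T z))) - (Y k t x - Y k t (T (T z)))
        + (Y m t (T (T z)) - Y k t (T (T z))) := by abel
    rw [dist_eq_norm, h8]
    have h9 := norm_add_le ((Y m t x - Y m t (T (T z))) - (Y k t x - Y k t (T (T z))))
      (Y m t (T (T z)) - Y k t (T (T z)))
    have h10 := norm_sub_le (Y m t x - Y m t (T (T z))) (Y k t x - Y k t (T (T z)))
    have h11 := h1 m
    have h12 := h1 k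
    change ‖Y m t (T (T z)) - Y k t (T (T z))‖ ≤ _ at h2
    linarith
  have hlim : ∀ t : ℝ, ∃ y, 0 ≤ t → Tendsto (fun k => Y k t x) atTop (𝓝 y) := by
    intro t
    by_cases ht : 0 ≤ t
    · obtain ⟨y, hy⟩ := cauchySeq_tendsto_of_complete ((hcauchy t).cauchySeq (right_mem_Icc.2 ht))
      exact ⟨y, fun _ => hy⟩
    · exact ⟨0, fun h => absurd h ht⟩
  choose y hy using hlim
  have hyc : ContinuousOn y (Ici 0) := by
    intro t ht
    have h1 : ContinuousOn y (Icc 0 (t + 1)) :=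
      ((hcauchy (t + 1)).tendstoUniformlyOn_of_tendsto fun s hs => hy s hs.1).continuousOn
        (Frequently.of_forall fun k => (hYc k x).continuousOn)
    refine (h1 t ⟨ht, by linarith⟩).mono_of_mem_nhdsWithin ?_
    rw [← Ici_inter_Iic]
    exact inter_mem self_mem_nhdsWithin (mem_nhdsWithin_of_mem_nhds (Iic_mem_nhds (by linarith)))
  have hy0 : y 0 = x := by
    refine tendsto_nhds_unique (hy 0 le_rfl) ?_
    simp [hY]
  -- The approximations satisfy `(T - ε) Y' = Y`; the limit is taken in the integrated form, since
  -- `Y'` need not converge.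
  have hint : ∀ t, 0 ≤ t → T (y t) = T x + ∫ s in (0 : ℝ)..t, y s := by
    intro t ht
    have h1 : ∀ k, T (Y k t x) - ε k • Y k t x = (T x - ε k • x) + ∫ s in (0 : ℝ)..t, Y k s x := by
      intro k
      have h2 : ∀ s : ℝ, HasDerivAt (fun s => (T - ε k • 1) (Y k s x)) (Y k s x) s := by
        intro s
        have := (T - ε k • 1).hasFDerivAt.comp_hasDerivAt s (hasDerivAt_exp_smul_apply (G k) x s)
        rwa [show (T - ε k • 1) (G k (NormedSpace.exp (s • G k) x)) = Y k s x from
          DFunLike.congr_fun (hG k).right_inv _] at this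
      have h3 := intervalIntegral.integral_eq_sub_of_hasDerivAt (fun s _ => h2 s)
        ((hYc k x).intervalIntegrable 0 t)
      rw [h3]
      simp [hY]
    have h4 : Tendsto (fun k => T (Y k t x) - ε k • Y k t x) atTop (𝓝 (T (y t) - (0 : ℝ) • y t)) :=
      ((T.continuous.tendsto _).comp (hy t ht)).sub (hεlim.smul (hy t ht))
    have h5 : Tendsto (fun k => (T x - ε k • x) + ∫ s in (0 : ℝ)..t, Y k s x) atTop
        (𝓝 ((T x - (0 : ℝ) • x) + ∫ s in (0 : ℝ)..t, y s)) := by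
      refine (tendsto_const_nhds.sub (hεlim.smul_const x)).add ?_
      refine intervalIntegral.tendsto_integral_filter_of_dominated_convergence (fun _ => ‖x‖)
        (Eventually.of_forall fun k => (hYc k x).aestronglyMeasurable) ?_ (by simp) ?_
      · refine Eventually.of_forall fun k => Eventually.of_forall fun s hs => hYle k s x ?_
        rw [uIoc_of_le ht] at hs
        exact hs.1.le
      · refine Eventually.of_forall fun s hs => hy s ?_
        rw [uIoc_of_le ht] at hs
        exact hs.1.le
    simp only [h1] at h4
    simpa using tendsto_nhds_unique h4 h5
  refine ⟨y, hyc, hy0, fun t ht => ?_⟩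
  exact ((hyc.hasDerivWithinAt_integral ht).const_add (T x)).congr hint (hint t ht)

/-- For `z` orthogonal to the range, dissipativity at `z + s T z` reads `s ‖T z‖² + O(s²) ≤ 0`.
Small `s > 0` forces `T z = 0`. -/
theorem IsDissipative.denseRange_of_injective {T : X →L[ℝ] X} (hT : IsDissipative T)
    (hi : ∀ x, T x = 0 → x = 0) : DenseRange T := by
  have h : (T.range).topologicalClosure = ⊤ := by
    rw [Submodule.topologicalClosure_eq_top_iff, Submodule.eq_bot_iff]
    intro z hz
    have hz' : ∀ w, ⟪T w, z⟫ = 0 := fun w =>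
      (Submodule.mem_orthogonal _ z).1 hz (T w) ⟨w, rfl⟩
    refine hi z ?_
    have hq : ∀ s : ℝ, s * ⟪T z, T z⟫ + s ^ 2 * ⟪T (T z), T z⟫ ≤ 0 := by
      intro s
      have := hT (z + s • T z)
      simp only [map_add, map_smul, inner_add_left, inner_add_right, inner_smul_left,
        inner_smul_right, hz'] at this
      simp at this
      rw [real_inner_self_eq_norm_sq]
      linarith
    by_contra hne
    have hpos : 0 < ⟪T z, T z⟫ := real_inner_self_pos.2 hne
    set a := ⟪T z, T z⟫
    set b := ⟪T (T z), T z⟫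
    -- This `s` is small enough that the linear term dominates: `s a + s² b = s² (|b| + 1 + b) > 0`.
    have h1 := hq (a / (|b| + 1))
    have hb : 0 < |b| + 1 := by positivity
    have h2 : a / (|b| + 1) * a + (a / (|b| + 1)) ^ 2 * b
        = (a / (|b| + 1)) ^ 2 * (|b| + 1 + b) := by
      field_simp
    rw [h2] at h1
    have h3 : 0 < |b| + 1 + b := by linarith [neg_abs_le b]
    have : 0 < (a / (|b| + 1)) ^ 2 * (|b| + 1 + b) := by positivity
    linarith
  intro x
  have : x ∈ (T.range).topologicalClosure := h ▸ Submodule.mem_top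
  rw [← SetLike.mem_coe, Submodule.topologicalClosure_coe] at this
  exact this

end Dissipative

/-! ### The abstract wave equation: energy identity, bound and uniqueness -/

section AbstractWave

variable {E H : Type*} [NormedAddCommGroup E] [InnerProductSpace ℝ E]
  [NormedAddCommGroup H] [InnerProductSpace ℝ H]

/-- The form `⟪u, w⟫ + ⟪Q u, w⟫` on the form domain `E`, embedded into `H` by `ι`. -/
def perturbedForm (ι : E →L[ℝ] H) (Q : H →L[ℝ] H) (u w : E) : ℝ := ⟪u, w⟫ + ⟪Q (ι u), ι w⟫

/-- `u` with time derivative `u'` is a weak solution of `u'' + A u = 0` on `[0, ∞)`, where `A` is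
the operator of the form `perturbedForm ι Q`. -/
structure IsFormSolution (ι : E →L[ℝ] H) (Q : H →L[ℝ] H) (u : ℝ → E) (u' : ℝ → H) : Prop where
  continuousOn : ContinuousOn u (Ici 0)
  continuousOn_deriv : ContinuousOn u' (Ici 0)
  hasDerivWithinAt : ∀ t, 0 ≤ t → HasDerivWithinAt (fun s => ι (u s)) (u' t) (Ici 0) t
  hasDerivAt_inner : ∀ w, ∀ t, 0 < t →
    HasDerivAt (fun s => ⟪u' s, ι w⟫) (-perturbedForm ι Q (u t) w) t

theorem eq_of_hasDerivAt_zero {f : ℝ → ℝ} (hc : ContinuousOn f (Ici 0))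
    (hd : ∀ t, 0 < t → HasDerivAt f 0 t) {t : ℝ} (ht : 0 ≤ t) : f t = f 0 := by
  rcases ht.eq_or_lt with rfl | ht
  · rfl
  obtain ⟨c, -, hc⟩ := exists_hasDerivAt_eq_slope f (fun _ => 0) ht
    (hc.mono Icc_subset_Ici_self) (fun s hs => hd s hs.1)
  rw [eq_comm, div_eq_zero_iff] at hc
  rcases hc with h | h <;> linarith

namespace IsFormSolution

variable {ι : E →L[ℝ] H} {Q : H →L[ℝ] H} {u w : ℝ → E} {u' w' : ℝ → H}

theorem sub (hu : IsFormSolution ι Q u u') (hw : IsFormSolution ι Q w w') :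
    IsFormSolution ι Q (fun t => u t - w t) (fun t => u' t - w' t) where
  continuousOn := hu.continuousOn.sub hw.continuousOn
  continuousOn_deriv := hu.continuousOn_deriv.sub hw.continuousOn_deriv
  hasDerivWithinAt t ht := by
    simpa using (hu.hasDerivWithinAt t ht).fun_sub (hw.hasDerivWithinAt t ht)
  hasDerivAt_inner z t ht := by
    simp only [inner_sub_left]
    refine ((hu.hasDerivAt_inner z t ht).fun_sub (hw.hasDerivAt_inner z t ht)).congr_deriv ?_
    simp only [perturbedForm, map_sub, inner_sub_left]
    ring

variable [CompleteSpace E]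

/-- The equation integrated once in time. The integral of `u` is differentiable in `E`, so its
derivative `u` becomes an admissible test vector. -/
theorem inner_deriv_add_perturbedForm_integral (hu : IsFormSolution ι Q u u') (z : E) {t : ℝ}
    (ht : 0 ≤ t) :
    ⟪u' t, ι z⟫ + perturbedForm ι Q (∫ s in (0 : ℝ)..t, u s) z = ⟪u' 0, ι z⟫ := by
  have hv := fun t (ht : 0 ≤ t) => hu.continuousOn.hasDerivWithinAt_integral ht
  have hvc : ContinuousOn (fun t => ∫ s in (0 : ℝ)..t, u s) (Ici 0) :=
    fun t ht => (hv t ht).continuousWithinAt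
  have := eq_of_hasDerivAt_zero
    (f := fun t => ⟪u' t, ι z⟫ + perturbedForm ι Q (∫ s in (0 : ℝ)..t, u s) z) ?_ ?_ ht
  · simpa [perturbedForm] using this
  · refine (hu.continuousOn_deriv.inner continuousOn_const).add ?_
    exact (hvc.inner continuousOn_const).add
      (((Q.comp ι).continuous.comp_continuousOn hvc).inner continuousOn_const)
  · intro s hs
    have hvs := (hv s hs.le).hasDerivAt (Ici_mem_nhds hs)
    have hq := (Q.comp ι).hasFDerivAt.comp_hasDerivAt s hvs
    refine ((hu.hasDerivAt_inner z s hs).fun_add ((hvs.inner ℝ (hasDerivAt_const s z)).fun_add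
      (hq.inner ℝ (hasDerivAt_const s (ι z))))).congr_deriv ?_
    simp [perturbedForm]

/-- Conservation of energy for the time integral of a solution. -/
theorem norm_sq_add_perturbedForm_integral (hu : IsFormSolution ι Q u u')
    (hQ : ∀ f g, ⟪Q f, g⟫ = ⟪f, Q g⟫) {t : ℝ} (ht : 0 ≤ t) :
    ‖ι (u t)‖ ^ 2 + perturbedForm ι Q (∫ s in (0 : ℝ)..t, u s) (∫ s in (0 : ℝ)..t, u s)
      = ‖ι (u 0)‖ ^ 2 + 2 * ⟪u' 0, ι (∫ s in (0 : ℝ)..t, u s)⟫ := by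
  have hv := fun t (ht : 0 ≤ t) => hu.continuousOn.hasDerivWithinAt_integral ht
  have hd : ∀ s, 0 ≤ s → HasDerivWithinAt (fun t => ‖ι (u t)‖ ^ 2
      + perturbedForm ι Q (∫ s in (0 : ℝ)..t, u s) (∫ s in (0 : ℝ)..t, u s)
      - 2 * ⟪u' 0, ι (∫ s in (0 : ℝ)..t, u s)⟫) 0 (Ici 0) s := by
    intro s hs
    have hι := ι.hasFDerivAt.comp_hasDerivWithinAt s (hv s hs)
    have hq := (Q.comp ι).hasFDerivAt.comp_hasDerivWithinAt s (hv s hs)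
    refine (((hu.hasDerivWithinAt s hs).norm_sq.fun_add (((hv s hs).inner ℝ (hv s hs)).fun_add
      (hq.inner ℝ hι))).fun_sub (((hasDerivWithinAt_const s _ (u' 0)).inner ℝ hι).const_mul
      2)).congr_deriv ?_
    -- The test vector is frozen at `u s`, the derivative of the time integral at `s`.
    have h1 := hu.inner_deriv_add_perturbedForm_integral (u s) hs
    simp only [perturbedForm] at h1
    simp only [ContinuousLinearMap.comp_apply, Function.comp_apply, inner_zero_left, add_zero, hQ]
    rw [← h1, hQ, real_inner_comm (u' s) (ι (u s)), real_inner_comm (u s),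
      real_inner_comm (Q (ι (∫ r in (0 : ℝ)..s, u r))), ← hQ]
    ring
  have := eq_of_hasDerivAt_zero (fun s hs => (hd s hs).continuousWithinAt)
    (fun s hs => (hd s hs.le).hasDerivAt (Ici_mem_nhds hs)) ht
  simp only [intervalIntegral.integral_same, map_zero, inner_zero_right, perturbedForm] at this ⊢
  linarith

/-- Hypothesis `hb` at the time integral cancels its form energy in the conservation law, leaving
`‖ι (u t)‖² ≤ ‖ι (u 0)‖² + K²`. -/
theorem norm_le (hu : IsFormSolution ι Q u u') (hQ : ∀ f g, ⟪Q f, g⟫ = ⟪f, Q g⟫) {K : ℝ}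
    (hK : 0 ≤ K) (hb : ∀ z, 2 * ⟪u' 0, ι z⟫ ≤ K ^ 2 + perturbedForm ι Q z z)
    {t : ℝ} (ht : 0 ≤ t) : ‖ι (u t)‖ ≤ ‖ι (u 0)‖ + K := by
  have h1 := hu.norm_sq_add_perturbedForm_integral hQ ht
  have h2 := hb (∫ s in (0 : ℝ)..t, u s)
  refine (abs_le_of_sq_le_sq' ?_ (by positivity)).2
  nlinarith [mul_nonneg (norm_nonneg (ι (u 0))) hK]

/-- The difference has zero data, so `norm_le` applies with `K = 0`. -/
theorem eq_of_initial_eq (hu : IsFormSolution ι Q u u') (hw : IsFormSolution ι Q w w')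
    (hQ : ∀ f g, ⟪Q f, g⟫ = ⟪f, Q g⟫) (hpos : ∀ z, 0 ≤ perturbedForm ι Q z z)
    (hι : Function.Injective ι) (h0 : u 0 = w 0) (h1 : u' 0 = w' 0) {t : ℝ} (ht : 0 ≤ t) :
    u t = w t := by
  have h := (hu.sub hw).norm_le hQ le_rfl (by simpa [h1] using hpos) ht
  simp only [h0, sub_self, map_zero, norm_zero, add_zero, norm_le_zero_iff, map_sub] at h
  exact hι (sub_eq_zero.1 h)

end IsFormSolution

/-! ### The abstract wave equation: existence -/

variable [CompleteSpace E] [CompleteSpace H]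

/-- Solvability of the resolvent equation `(A + κ²) p = -(g + κ f)`, with `A` the operator of
`perturbedForm ι Q`. -/
theorem exists_resolvent (ι : E →L[ℝ] H) (Q : H →L[ℝ] H) {κ : ℝ} (hκ : ‖Q‖ ≤ κ ^ 2) :
    ∃ P : WithLp 2 (E × H) →L[ℝ] E, ∀ z w,
      perturbedForm ι Q (P z) w + κ ^ 2 * ⟪ι (P z), ι w⟫ = -⟪z.snd + κ • ι z.fst, ι w⟫ := by
  let K : E →L[ℝ] E := 1 + ι.adjoint.comp ((Q + κ ^ 2 • 1).comp ι)
  have hK : ∀ u w, ⟪K u, w⟫ = perturbedForm ι Q u w + κ ^ 2 * ⟪ι u, ι w⟫ := by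
    intro u w
    simp [K, perturbedForm, inner_add_left, inner_smul_left,
      ContinuousLinearMap.adjoint_inner_left, add_assoc]
  let B : E →L[ℝ] E →L[ℝ] ℝ := (innerSL ℝ).comp K
  have hB : IsCoercive B := by
    refine ⟨1, one_pos, fun u => ?_⟩
    have h1 : B u u = ⟪K u, u⟫ := rfl
    rw [h1, hK, perturbedForm, real_inner_self_eq_norm_sq, real_inner_self_eq_norm_sq]
    have h2 := neg_le_of_abs_le (abs_real_inner_le_norm (Q (ι u)) (ι u))
    have h3 : ‖Q (ι u)‖ * ‖ι u‖ ≤ κ ^ 2 * ‖ι u‖ ^ 2 := by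
      have := (Q.le_opNorm (ι u)).trans
        (mul_le_mul_of_nonneg_right hκ (norm_nonneg (ι u)))
      nlinarith [norm_nonneg (ι u)]
    nlinarith
  let e := hB.continuousLinearEquivOfBilin
  have he : ∀ x, e x = K x := fun x =>
    (hB.unique_continuousLinearEquivOfBilin (v := x) (f := K x) fun w => rfl).symm
  refine ⟨-(e.symm : E →L[ℝ] E).comp (ι.adjoint.comp
    (WithLp.sndL 2 ℝ E H + κ • ι.comp (WithLp.fstL 2 ℝ E H))), fun z w => ?_⟩
  rw [← hK, ← he]
  simp [ContinuousLinearMap.adjoint_inner_left, inner_add_left, inner_neg_left, inner_smul_left]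

theorem exists_isFormSolution (ι : E →L[ℝ] H) (Q : H →L[ℝ] H) (hι : ∀ p, ‖ι p‖ ≤ ‖p‖)
    (hinj : Function.Injective ι) (hdense : ∀ g, (∀ w, ⟪g, ι w⟫ = 0) → g = 0) (u₀ : E) (u₁ : H) :
    ∃ u u', IsFormSolution ι Q u u' ∧ u 0 = u₀ ∧ u' 0 = u₁ := by
  -- `κ ≥ ‖Q‖` gives dissipativity; `κ ≥ 1` then gives `‖Q‖ ≤ κ²`, needed for the resolvent.
  set κ : ℝ := ‖Q‖ + 1 with hκdef
  have hκ1 : 1 ≤ κ := by simp [hκdef]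
  have hκQ : ‖Q‖ ≤ κ := by simp [hκdef]
  obtain ⟨P, hP⟩ := exists_resolvent ι Q (κ := κ) (by nlinarith)
  let T₂ : WithLp 2 (E × H) →L[ℝ] H := ι.comp (WithLp.fstL 2 ℝ E H + κ • P)
  let T : WithLp 2 (E × H) →L[ℝ] WithLp 2 (E × H) :=
    (WithLp.prodContinuousLinearEquiv 2 ℝ E H).symm.toContinuousLinearMap.comp (P.prod T₂)
  have hT1 : ∀ z, (T z).fst = P z := fun z => rfl
  have hT2 : ∀ z, (T z).snd = ι (z.fst + κ • P z) := fun z => rfl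
  -- With `(p, q) = T z`, the `E` inner product cancels against that in the form, leaving `-κ‖p‖² -
  -- κ‖q‖² - ⟪Q p, q⟫ ≤ 0` (`ι` suppressed).
  have hT : IsDissipative T := by
    intro z
    have h1 : ⟪T z, z⟫ = ⟪P z, z.fst⟫ + ⟪ι (z.fst + κ • P z), z.snd⟫ := WithLp.prod_inner_apply _ _
    set p := P z
    set q := z.fst + κ • p with hq
    have h2 : z.fst = q - κ • p := by simp [hq]
    have h3 := hP z q
    rw [h2] at h3
    change perturbedForm ι Q p q + κ ^ 2 * ⟪ι p, ι q⟫ = _ at h3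
    rw [h1, h2, real_inner_comm]
    simp only [perturbedForm, map_sub, map_smul, inner_add_left, inner_sub_left, inner_smul_left,
      smul_sub, real_inner_self_eq_norm_sq, RCLike.conj_to_real] at h3 ⊢
    have h4 := neg_le_of_abs_le (abs_real_inner_le_norm (Q (ι p)) (ι q))
    have h5 : ‖Q (ι p)‖ ≤ κ * ‖p‖ := (Q.le_opNorm (ι p)).trans
      (mul_le_mul hκQ (hι p) (norm_nonneg _) (by linarith))
    have h6 : ‖Q (ι p)‖ * ‖ι q‖ ≤ κ * ‖p‖ * ‖ι q‖ :=
      mul_le_mul_of_nonneg_right h5 (norm_nonneg _)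
    have h7 : κ * ‖p‖ * ‖ι q‖ ≤ κ * ‖p‖ ^ 2 + κ * ‖ι q‖ ^ 2 := by
      have : ‖p‖ * ‖ι q‖ ≤ ‖p‖ ^ 2 + ‖ι q‖ ^ 2 := by
        nlinarith [sq_nonneg (‖p‖ - ‖ι q‖), sq_nonneg ‖p‖, sq_nonneg ‖ι q‖]
      nlinarith
    rw [real_inner_comm z.snd, real_inner_comm p q]
    linarith
  have hker : ∀ z, T z = 0 → z = 0 := by
    intro z hz
    have h1 : P z = 0 := by rw [← hT1, hz]; rfl
    have h2 : z.fst = 0 := by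
      have : ι (z.fst + κ • P z) = 0 := by rw [← hT2, hz]; rfl
      rw [h1, smul_zero, add_zero] at this
      exact hinj (this.trans (map_zero ι).symm)
    have h3 : z.snd = 0 := hdense _ fun w => by
      have := hP z w
      simpa [h1, h2, perturbedForm] using this
    exact WithLp.ofLp_injective 2 (Prod.ext h2 h3)
  obtain ⟨y, hyc, hy0, hyd⟩ := hT.exists_flow (hT.denseRange_of_injective hker)
    (WithLp.toLp 2 (u₀, u₁))
  have hfc : ContinuousOn (fun t => (y t).fst) (Ici 0) :=
    (WithLp.fstL 2 ℝ E H).continuous.comp_continuousOn hyc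
  have hsc : ContinuousOn (fun t => (y t).snd) (Ici 0) :=
    (WithLp.sndL 2 ℝ E H).continuous.comp_continuousOn hyc
  have hexp : ∀ t : ℝ, HasDerivAt (fun s => Real.exp (κ * s)) (κ * Real.exp (κ * t)) t := fun t => by
    simpa [mul_comm] using ((hasDerivAt_id t).const_mul κ).exp
  have hexpc : Continuous fun s => Real.exp (κ * s) := by fun_prop
  have hpd : ∀ t, 0 ≤ t → HasDerivWithinAt (fun s => P (y s)) (y t).fst (Ici 0) t := fun t ht =>
    (WithLp.fstL 2 ℝ E H).hasFDerivAt.comp_hasDerivWithinAt t (hyd t ht)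
  have hqd : ∀ t, 0 ≤ t →
      HasDerivWithinAt (fun s => ι ((y s).fst + κ • P (y s))) (y t).snd (Ici 0) t := fun t ht =>
    (WithLp.sndL 2 ℝ E H).hasFDerivAt.comp_hasDerivWithinAt t (hyd t ht)
  have hιd : ∀ t, 0 ≤ t →
      HasDerivWithinAt (fun s => ι (y s).fst) ((y t).snd - κ • ι (y t).fst) (Ici 0) t := by
    intro t ht
    have h1 := (hqd t ht).fun_sub
      ((ι.hasFDerivAt.comp_hasDerivWithinAt t (hpd t ht)).const_smul κ)
    refine h1.congr (fun s _ => ?_) ?_ <;> simp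
  -- The exponential undoes the shift of the generator by `κ`.
  refine ⟨fun t => Real.exp (κ * t) • (y t).fst, fun t => Real.exp (κ * t) • (y t).snd,
    ⟨hexpc.continuousOn.smul hfc, hexpc.continuousOn.smul hsc, fun t ht => ?_, fun w t ht => ?_⟩,
    by simp [hy0], by simp [hy0]⟩
  · simp only [map_smul]
    refine ((hexp t).hasDerivWithinAt.smul (hιd t ht)).congr_deriv ?_
    rw [smul_sub, smul_smul, mul_comm κ (Real.exp _)]
    abel
  · have hp := (hpd t ht.le).hasDerivAt (Ici_mem_nhds ht)
    have hi := (hιd t ht.le).hasDerivAt (Ici_mem_nhds ht)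
    have hQp := (Q.comp ι).hasFDerivAt.comp_hasDerivAt t hp
    have hιp := ι.hasFDerivAt.comp_hasDerivAt t hp
    -- Only `T y` is known to be differentiable, so the resolvent equation is used to express the
    -- pairing through `P y` and `ι (y s).fst`, whose derivatives are available.
    have h1 : ∀ s, ⟪(y s).snd, ι w⟫ = -(κ * ⟪ι (y s).fst, ι w⟫)
        - (⟪P (y s), w⟫ + ⟪Q (ι (P (y s))), ι w⟫) - κ ^ 2 * ⟪ι (P (y s)), ι w⟫ := by
      intro s
      have := hP (y s) w
      rw [inner_add_left, inner_smul_left, perturbedForm] at this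
      simp only [RCLike.conj_to_real] at this
      linarith
    have h2 : HasDerivAt (fun s => ⟪(y s).snd, ι w⟫)
        (-(κ * ⟪(y t).snd, ι w⟫) - perturbedForm ι Q (y t).fst w) t := by
      simp only [h1]
      refine ((((hi.inner ℝ (hasDerivAt_const t (ι w))).const_mul κ).fun_neg.fun_sub
        ((hp.inner ℝ (hasDerivAt_const t w)).fun_add
          (hQp.inner ℝ (hasDerivAt_const t (ι w))))).fun_sub
        ((hιp.inner ℝ (hasDerivAt_const t (ι w))).const_mul (κ ^ 2))).congr_deriv ?_
      simp only [inner_zero_right, zero_add, ← h1, perturbedForm, inner_sub_left, inner_smul_left,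
        RCLike.conj_to_real, ContinuousLinearMap.comp_apply]
      ring
    simp only [inner_smul_left, RCLike.conj_to_real]
    refine ((hexp t).fun_mul h2).congr_deriv ?_
    simp only [perturbedForm, map_smul, inner_smul_left, RCLike.conj_to_real]
    ring

end AbstractWave

/-! ### The Sobolev space, multiplication by the potential, and the weighted bound -/

section Concrete

variable {n : ℕ}

theorem L2.inner_eq_integral_mul (f g : L2 n) : ⟪f, g⟫ = ∫ x, f x * g x := by
  rw [MeasureTheory.L2.inner_def]
  refine integral_congr_ae (Eventually.of_forall fun x => ?_)
  simp [mul_comm]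

/-- A continuous compactly supported function as an element of `L²`. -/
def testL2 {φ : Space n → ℝ} (hφ : Continuous φ) (hc : HasCompactSupport φ) : L2 n :=
  (hφ.memLp_of_hasCompactSupport hc).toLp φ

theorem inner_testL2 (f : L2 n) {φ : Space n → ℝ} (hφ : Continuous φ) (hc : HasCompactSupport φ) :
    ⟪f, testL2 hφ hc⟫ = ∫ x, f x * φ x := by
  rw [L2.inner_eq_integral_mul]
  refine integral_congr_ae ?_
  filter_upwards [(hφ.memLp_of_hasCompactSupport (p := 2) (μ := volume) hc).coeFn_toLp] with x hx
  rw [testL2, hx]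

theorem L2.eq_zero_of_integral_mul_test {f : L2 n} (h : ∀ φ : Space n → ℝ, ContDiff ℝ ∞ φ →
    HasCompactSupport φ → ∫ x, f x * φ x = 0) : f = 0 := by
  rw [Lp.eq_zero_iff_ae_eq_zero]
  refine ae_eq_zero_of_integral_contDiff_smul_eq_zero
    ((Lp.memLp f).locallyIntegrable (by norm_num)) fun φ hφ hc => ?_
  rw [← h φ hφ hc]
  simp only [smul_eq_mul, mul_comm]

/-- Each test function imposes an equality of two continuous functionals. -/
theorem isClosed_h1Submodule : IsClosed (SetLike.coe (h1Submodule n)) := by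
  have h : (h1Submodule n : Set (WithLp 2 (L2 n × PiLp 2 (fun _ : Fin n => L2 n)))) =
      ⋂ (i : Fin n) (φ : Space n → ℝ) (hφ : ContDiff ℝ ∞ φ) (hc : HasCompactSupport φ),
        {p | ⟪p.fst, testL2 (continuous_partial i hφ) (hc.fderiv_apply (𝕜 := ℝ) _)⟫
          = -⟪p.snd i, testL2 hφ.continuous hc⟫} := by
    ext p
    simp only [mem_iInter, mem_ofPred_eq, inner_testL2]
    rfl
  rw [h]
  refine isClosed_iInter fun i => isClosed_iInter fun φ => isClosed_iInter fun hφ =>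
    isClosed_iInter fun hc => isClosed_eq ?_ ?_
  · exact (WithLp.fstL 2 ℝ _ _).continuous.inner continuous_const
  · exact (((PiLp.proj 2 (fun _ : Fin n => L2 n) i : _ →L[ℝ] _).continuous.comp
      (WithLp.sndL 2 ℝ _ _).continuous).inner continuous_const).neg

instance : CompleteSpace (H1 n) := isClosed_h1Submodule.completeSpace_coe

/-- The embedding of `H¹` into `L²`. -/
def H1.toL2L (n : ℕ) : H1 n →L[ℝ] L2 n :=
  (WithLp.fstL 2 ℝ (L2 n) (PiLp 2 (fun _ : Fin n => L2 n))).comp (h1Submodule n).subtypeL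

@[simp] theorem H1.toL2L_apply (u : H1 n) : H1.toL2L n u = u.toL2 := rfl

theorem H1.inner_eq (u w : H1 n) :
    ⟪u, w⟫ = (∑ i, ⟪u.partialDeriv i, w.partialDeriv i⟫) + ⟪u.toL2, w.toL2⟫ := by
  rw [Submodule.coe_inner, WithLp.prod_inner_apply, add_comm, PiLp.inner_apply]
  rfl

theorem H1.norm_toL2_le (u : H1 n) : ‖u.toL2‖ ≤ ‖u‖ := by
  have h := H1.inner_eq u u
  simp only [real_inner_self_eq_norm_sq] at h
  have := Finset.sum_nonneg fun i (_ : i ∈ Finset.univ) => sq_nonneg ‖u.partialDeriv i‖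
  exact (abs_le_of_sq_le_sq' (by linarith) (norm_nonneg _)).2

/-- Uniqueness of weak derivatives: those of `0` vanish against every test function. -/
theorem H1.toL2L_injective : Function.Injective (H1.toL2L n) := by
  rw [injective_iff_map_eq_zero]
  intro u hu
  have h0 : u.toL2 = 0 := hu
  have h1 : ∀ i, u.partialDeriv i = 0 := fun i => L2.eq_zero_of_integral_mul_test fun φ hφ hc => by
    have h2 : IsWeakPartial i u.toL2 (u.partialDeriv i) := u.2 i
    rw [h0] at h2
    have h3 := h2 φ hφ hc
    rw [IsWeakPartial.zero i φ hφ hc] at h3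
    have h4 : ∫ x, (0 : L2 n) x * φ x = 0 := by
      rw [← inner_testL2 0 hφ.continuous hc, inner_zero_left]
    linarith
  have h2 := H1.inner_eq u u
  simpa [h0, h1] using h2

theorem isWeakPartial_testL2 (i : Fin n) {φ : Space n → ℝ} (hφ : ContDiff ℝ ∞ φ)
    (hc : HasCompactSupport φ) : IsWeakPartial i (testL2 hφ.continuous hc)
      (testL2 (continuous_partial i hφ) (hc.fderiv_apply (𝕜 := ℝ) _)) := by
  intro ψ hψ hcψ
  have hcψ' := hcψ.fderiv_apply (𝕜 := ℝ) (EuclideanSpace.single i (1 : ℝ))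
  have hc' := hc.fderiv_apply (𝕜 := ℝ) (EuclideanSpace.single i (1 : ℝ))
  rw [← inner_testL2 _ (continuous_partial i hψ) hcψ', ← inner_testL2 _ hψ.continuous hcψ,
    real_inner_comm, inner_testL2, real_inner_comm, inner_testL2]
  have h1 : ∫ x, testL2 (continuous_partial i hψ) hcψ' x * φ x
      = ∫ x, φ x * fderiv ℝ ψ x (EuclideanSpace.single i 1) := by
    refine integral_congr_ae ?_
    filter_upwards [((continuous_partial i hψ).memLp_of_hasCompactSupport (p := 2) (μ := volume)
      hcψ').coeFn_toLp] with x hx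
    rw [testL2, hx, mul_comm]
  have h2 : ∫ x, testL2 hψ.continuous hcψ x * fderiv ℝ φ x (EuclideanSpace.single i 1)
      = ∫ x, fderiv ℝ φ x (EuclideanSpace.single i 1) * ψ x := by
    refine integral_congr_ae ?_
    filter_upwards [(hψ.continuous.memLp_of_hasCompactSupport (p := 2) (μ := volume)
      hcψ).coeFn_toLp] with x hx
    rw [testL2, hx, mul_comm]
  rw [h1, h2]
  exact integral_mul_fderiv_eq_neg_fderiv_mul_of_integrable
    (((continuous_partial i hφ).mul hψ.continuous).integrable_of_hasCompactSupport hc'.mul_right)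
    ((hφ.continuous.mul (continuous_partial i hψ)).integrable_of_hasCompactSupport hc.mul_right)
    ((hφ.continuous.mul hψ.continuous).integrable_of_hasCompactSupport hc.mul_right)
    (fun x _ => (hφ.differentiable (by simp)).differentiableAt)
    (fun x _ => (hψ.differentiable (by simp)).differentiableAt)

/-- Density of `H¹` in `L²`: test functions belong to `H¹`. -/
theorem L2.eq_zero_of_inner_toL2 {g : L2 n} (h : ∀ w : H1 n, ⟪g, w.toL2⟫ = 0) : g = 0 :=
  L2.eq_zero_of_integral_mul_test fun φ hφ hc => by
    rw [← inner_testL2 g hφ.continuous hc]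
    exact h ⟨WithLp.toLp 2 (testL2 hφ.continuous hc, WithLp.toLp 2 fun i =>
      testL2 (continuous_partial i hφ) (hc.fderiv_apply (𝕜 := ℝ) _)),
      fun i => isWeakPartial_testL2 i hφ hc⟩

theorem memLp_bcf_mul (W : Space n →ᵇ ℝ) (f : L2 n) : MemLp (fun x => W x * f x) 2 volume :=
  (Lp.memLp f).of_le_mul (W.continuous.aestronglyMeasurable.mul (Lp.aestronglyMeasurable f))
    (c := ‖W‖) (Eventually.of_forall fun x => by
      rw [norm_mul]
      exact mul_le_mul_of_nonneg_right (W.norm_coe_le_norm x) (norm_nonneg _))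

/-- Multiplication by a bounded continuous function on `L²`. -/
def mulL2 (W : Space n →ᵇ ℝ) : L2 n →L[ℝ] L2 n :=
  LinearMap.mkContinuous
    { toFun := fun f => (memLp_bcf_mul W f).toLp _
      map_add' := fun f g => by
        rw [← MemLp.toLp_add]
        refine MemLp.toLp_congr _ _ ?_
        filter_upwards [Lp.coeFn_add f g] with x hx
        simp only [hx, Pi.add_apply, mul_add]
      map_smul' := fun c f => by
        rw [RingHom.id_apply, ← MemLp.toLp_const_smul]
        refine MemLp.toLp_congr _ _ ?_
        filter_upwards [Lp.coeFn_smul c f] with x hx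
        simp only [hx, Pi.smul_apply, smul_eq_mul]
        ring } ‖W‖ (fun f => by
      refine Lp.norm_le_mul_norm_of_ae_le_mul ?_
      filter_upwards [(memLp_bcf_mul W f).coeFn_toLp] with x hx
      simp only [LinearMap.coe_mk, AddHom.coe_mk]
      rw [hx, norm_mul]
      exact mul_le_mul_of_nonneg_right (W.norm_coe_le_norm x) (norm_nonneg _))

theorem coeFn_mulL2 (W : Space n →ᵇ ℝ) (f : L2 n) : mulL2 W f =ᵐ[volume] fun x => W x * f x :=
  (memLp_bcf_mul W f).coeFn_toLp

theorem inner_mulL2 (W : Space n →ᵇ ℝ) (f g : L2 n) :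
    ⟪mulL2 W f, g⟫ = ∫ x, W x * f x * g x := by
  rw [L2.inner_eq_integral_mul]
  refine integral_congr_ae ?_
  filter_upwards [coeFn_mulL2 W f] with x hx
  rw [hx]

theorem mulL2_symmetric (W : Space n →ᵇ ℝ) (f g : L2 n) : ⟪mulL2 W f, g⟫ = ⟪f, mulL2 W g⟫ := by
  rw [real_inner_comm _ f, inner_mulL2, inner_mulL2]
  refine integral_congr_ae (Eventually.of_forall fun x => ?_)
  ring

/-- The `-1` compensates the `L²` term contained in the `H¹` inner product. -/
theorem energyForm_eq_perturbedForm (V : Space n →ᵇ ℝ) (u w : H1 n) :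
    energyForm V u w = perturbedForm (H1.toL2L n) (mulL2 V - 1) u w := by
  rw [energyForm, perturbedForm, H1.inner_eq, ← inner_mulL2, sub_apply, one_apply_eq_self,
    inner_sub_left]
  simp only [← L2.inner_eq_integral_mul, H1.toL2L_apply]
  ring

theorem sub_one_symmetric (V : Space n →ᵇ ℝ) (f g : L2 n) :
    ⟪(mulL2 V - 1) f, g⟫ = ⟪f, (mulL2 V - 1) g⟫ := by
  simp only [sub_apply, one_apply_eq_self, inner_sub_left, inner_sub_right, mulL2_symmetric]

theorem isWeakSolution_iff (V : Space n →ᵇ ℝ) (u₀ : H1 n) (u₁ : L2 n) (u : ℝ → H1 n) :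
    IsWeakSolution V u₀ u₁ u ↔
      ∃ u', IsFormSolution (H1.toL2L n) (mulL2 V - 1) u u' ∧ u 0 = u₀ ∧ u' 0 = u₁ := by
  constructor
  · rintro ⟨hc, h0, u', hc', h1, hd, hw⟩
    refine ⟨u', ⟨hc, hc', hd, fun w t ht => ?_⟩, h0, h1⟩
    simp only [H1.toL2L_apply, L2.inner_eq_integral_mul, ← energyForm_eq_perturbedForm]
    exact hw w t ht
  · rintro ⟨u', hu, h0, h1⟩
    refine ⟨hu.continuousOn, h0, u', hu.continuousOn_deriv, h1, hu.hasDerivWithinAt,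
      fun w t ht => ?_⟩
    simp only [energyForm_eq_perturbedForm, ← L2.inner_eq_integral_mul]
    exact hu.hasDerivAt_inner w t ht

theorem integrable_bcf_mul_mul (V : Space n →ᵇ ℝ) (f : L2 n) :
    Integrable (fun x => V x * f x * f x) :=
  (memLp_bcf_mul V f).integrable_mul (Lp.memLp f)

theorem energyForm_ge (V : Space n →ᵇ ℝ) (u : H1 n) :
    ∫ x, V x * u.toL2 x * u.toL2 x ≤ energyForm V u u := by
  rw [energyForm]
  have := Finset.sum_nonneg fun i (_ : i ∈ Finset.univ) =>
    integral_nonneg (μ := volume) (f := fun x => u.partialDeriv i x * u.partialDeriv i x)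
      fun x => mul_self_nonneg _
  linarith

theorem energyForm_nonneg {V : Space n →ᵇ ℝ} (hV : ∀ x, 0 < V x) (u : H1 n) :
    0 ≤ energyForm V u u := by
  refine le_trans (integral_nonneg fun x => ?_) (energyForm_ge V u)
  simp only [Pi.zero_apply, mul_assoc]
  exact mul_nonneg (hV x).le (mul_self_nonneg _)

/-- Completing the square pointwise: the defect is `(f - V u)² / V ≥ 0`. -/
theorem two_mul_inner_le {V : Space n →ᵇ ℝ} (hV : ∀ x, 0 < V x) {f : L2 n}
    (hf : Integrable (fun x => |f x| ^ 2 / V x)) (u : H1 n) :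
    2 * ⟪f, u.toL2⟫ ≤ (∫ x, |f x| ^ 2 / V x) + energyForm V u u := by
  refine le_trans ?_ (add_le_add_right (energyForm_ge V u) _)
  rw [← integral_add hf (integrable_bcf_mul_mul V _), L2.inner_eq_integral_mul,
    ← integral_const_mul]
  refine integral_mono (((Lp.memLp f).integrable_mul (Lp.memLp u.toL2)).const_mul 2)
    (hf.add (integrable_bcf_mul_mul V _)) fun x => ?_
  have h := hV x
  have h1 : |f x| ^ 2 / V x + V x * u.toL2 x * u.toL2 x - 2 * (f x * u.toL2 x)
      = (f x - V x * u.toL2 x) ^ 2 / V x := by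
    rw [sq_abs]
    field_simp
    ring
  have h2 : 0 ≤ (f x - V x * u.toL2 x) ^ 2 / V x := by positivity
  simp only
  linarith

end Concrete

end WavePotential

end

open WavePotential in
theorem theorem1p1 :
    ∃ C : ℝ, 0 < C ∧
      ∀ (n : ℕ), 1 ≤ n →
      ∀ (V : BoundedContinuousFunction (WavePotential.Space n) ℝ), (∀ x, 0 < V x) →
      ∀ (u₀ : WavePotential.H1 n) (u₁ : WavePotential.L2 n),
        MeasureTheory.Integrable (fun x => |u₁ x| ^ 2 / V x) MeasureTheory.volume →
        ∃ u : ℝ → WavePotential.H1 n,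
          WavePotential.IsWeakSolution V u₀ u₁ u ∧
          (∀ w : ℝ → WavePotential.H1 n, WavePotential.IsWeakSolution V u₀ u₁ w →
            ∀ t, 0 ≤ t → w t = u t) ∧
          ∀ t, 0 ≤ t →
            ‖(u t).toL2‖ ≤ C * (‖u₀.toL2‖ + √(∫ x, |u₁ x| ^ 2 / V x)) := by
  refine ⟨1, one_pos, fun n _ V hV u₀ u₁ hI => ?_⟩
  obtain ⟨u, u', hu, h0, h1⟩ := exists_isFormSolution (H1.toL2L n) (mulL2 V - 1) H1.norm_toL2_le
    H1.toL2L_injective (fun g hg => L2.eq_zero_of_inner_toL2 hg) u₀ u₁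
  refine ⟨u, (isWeakSolution_iff V u₀ u₁ u).2 ⟨u', hu, h0, h1⟩, fun w hw t ht => ?_, fun t ht => ?_⟩
  · obtain ⟨w', hw, hw0, hw1⟩ := (isWeakSolution_iff V u₀ u₁ w).1 hw
    refine hw.eq_of_initial_eq hu (sub_one_symmetric V) (fun z => ?_) H1.toL2L_injective
      (hw0.trans h0.symm) (hw1.trans h1.symm) ht
    rw [← energyForm_eq_perturbedForm]
    exact energyForm_nonneg hV z
  · have hnn : 0 ≤ ∫ x, |u₁ x| ^ 2 / V x :=
      MeasureTheory.integral_nonneg fun x => div_nonneg (sq_nonneg _) (hV x).le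
    have h := hu.norm_le (sub_one_symmetric V) (Real.sqrt_nonneg (∫ x, |u₁ x| ^ 2 / V x))
      (fun z => ?_) ht
    · rw [h0] at h
      simpa using h
    · rw [← energyForm_eq_perturbedForm, Real.sq_sqrt hnn, h1]
      exact two_mul_inner_le hV hI z
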